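/- Let $q$ be a power of an odd prime, let $\chi$ be a nontrivial additive character of $\mathbb{F}_q$, let $O(2)=\{g\in Mat_2(\mathbb{F}_q): g g^{T}=I\}$, and for $A\in Mat_2(\mathbb{F}_q)$ put \[ \lambda_A=\sum_{g\in O(2)}\chi(\operatorname{Tr}(Ag)), \] the eigenvalue, for the eigenfunction $X\mapsto\chi(\operatorname{Tr}(AX))$, of the Cayley digraph on $Mat_2(\mathbb{F}_q)$ with an edge from $X$ to $Y$ when $Y-X\in O(2)$. Let $i$ be a square root of $-1$ in $\mathbb{F}_q$ or in an extension field of it. Let $A$ be a $2\times 2$ matrix of rank one over $\mathbb{F}_q$, and write $A=w\,(a,b)$ as the product of a column vector $w\in\mathbb{F}_q^2$ and a row vector $(a,b)\in\mathbb{F}_q^2$ (for example, $(a,b)$ is the first nonzero row of $A$). If $a\neq bi$ and $a\neq -bi$, then $|\lambda_A|\le 4\sqrt{q}$. If $a=bi$ or $a=-bi$, then \[ |\lambda_A|\le (q\pm 1)+2\sqrt{q}, \] with the sign $+$ when $q\equiv 3 \pmod 4$ and $-$ otherwise. -/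

import Mathlib

open Classical in
/-- For a set `G` of `n × n` matrices over a finite field `F` and an additive character `χ` of `F`,
the eigenvalue `λ_A = ∑_{g ∈ G} χ (Tr (A g))` of the Cayley digraph on `Mat_n(F)` (with an edge from
`X` to `Y` when `Y - X ∈ G`) that belongs to the eigenfunction `X ↦ χ (Tr (A X))`. -/
noncomputable def cayleyEigenvalue {F : Type*} [Field F] [Fintype F] {n : Type*} [Fintype n]
    (G : Set (Matrix n n F)) (χ : AddChar F ℂ) (A : Matrix n n F) : ℂ :=
  ∑ g : Matrix n n F with g ∈ G, χ (A * g).trace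

/-!
The group `O(2)` consists of two copies of the circle `x ^ 2 + y ^ 2 = 1`, the rotations and the
reflections, so for a matrix `A` of rank one `λ_A` is a sum of two Fourier coefficients
`∑ χ (u * x + v * y)` of the circle (`cayleyEigenvalue_orthogonalGroup_vecMulVec`). The frequencies
are both nonzero when `(a, b)` is not isotropic, and at least one is nonzero in any case. At the
frequency zero the sum is the size `q - η (-1)` of the circle, where `η` is the quadratic character.
It remains to bound the sum by `2 √q` at a nonzero frequency. For an isotropic frequency the value is
`-1`. Otherwise counting points on lines turns it into
`T = ∑ t, χ t * η (c - t ^ 2)` with `c ≠ 0` (`circleSum_eq_conicSum`).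

The Weil bound `|T| ≤ 2 √q` (`norm_conicSum_le`) is proved without zeta functions. Passing from a
field `K` with `Q` elements to its quadratic extension changes `T` into `2 Q - T ^ 2`
(`QuadraticAlgebra.conicSum_eq`), so that `x = -T / √Q` is replaced by `x ^ 2 - 2`. This map keeps
every real value at least `-2` after one step, but its iterates are unbounded if `|x| > 2`. On the
other hand, summing `T` over all characters of `F`, composed with the trace from the extension,
gives the character sum `∑ z, η (c - (z ^ q - z) ^ 2)` of a hyperelliptic curve independent of the
extension (`sum_conicSum_compAddMonoidHom`), for which Stepanov's method in Bombieri's form yields a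
lower bound `-C √Q` (`neg_le_sum_quadraticChar_sub_sq`). Hence the values of `x` stay bounded along
the tower of quadratic extensions, and `|x| ≤ 2` at the bottom.

Stepanov's method is simple here because `Q = R ^ 2` is a square: one finds by linear algebra a
nonzero polynomial of degree `Q / 2 + O(R)` vanishing wherever the defining polynomial `g` takes a
nonsquare value, and no derivatives are needed.
-/

/-! ### Stepanov's method for hyperelliptic curves -/

open Polynomial in
/-- A nonzero polynomial in `X`, `Y` of degree less than `R` in `X` does not vanish under
`Y = X ^ R`, by uniqueness of the expansion to the base `X ^ R`. -/
theorem Polynomial.eq_zero_of_eval_X_pow_eq_zero {K : Type*} [Field K] {R : ℕ}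
    (D : K[X][X]) (hdeg : ∀ j, (D.coeff j).degree < R) (hD : D.eval (X ^ R) = 0) : D = 0 := by
  induction h : D.natDegree using Nat.strong_induction_on generalizing D with
  | _ n ih =>
    have h0 : D.coeff 0 = 0 := by
      have h1 := congrArg (eval (X ^ R : K[X])) (divX_mul_X_add D)
      rw [hD, eval_add, eval_mul, eval_X, eval_C] at h1
      by_contra hne
      have h2 : (X : K[X]) ^ R ∣ D.coeff 0 :=
        ⟨-eval (X ^ R) D.divX, by linear_combination h1⟩
      have h3 := degree_le_of_dvd h2 hne
      rw [degree_X_pow] at h3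
      exact absurd (hdeg 0) (not_lt.2 h3)
    have hX : D = D.divX * X := by
      conv_lhs => rw [← divX_mul_X_add D, h0, C_0, add_zero]
    by_cases hn : D.divX = 0
    · rw [hX, hn, zero_mul]
    have hev : D.divX.eval (X ^ R) = 0 := by
      have h1 := hD
      rw [hX, eval_mul, eval_X] at h1
      exact (mul_eq_zero.1 h1).resolve_right (pow_ne_zero _ X_ne_zero)
    refine absurd (ih D.divX.natDegree ?_ D.divX (fun j => ?_) hev rfl) hn
    · rw [← h, hX, natDegree_mul_X hn, ← hX]
      exact Nat.lt_succ_self _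
    · rw [coeff_divX]; exact hdeg _

theorem Squarefree.isUnit_of_mul_sq_eq_sq {M : Type*} [CommRing M] [IsDomain M]
    [UniqueFactorizationMonoid M] {g u a b : M} (hg : Squarefree g) (hu : IsUnit u) (hb : b ≠ 0)
    (h : a ^ 2 = g * u * b ^ 2) : IsUnit g := by
  obtain ⟨e, rfl⟩ : b ∣ a := by
    exact (UniqueFactorizationMonoid.pow_dvd_pow_iff_dvd two_ne_zero).1 ⟨g * u, by rw [h]; ring⟩
  have h1 : e * e = g * u := by
    have : b ^ 2 * (e * e) = b ^ 2 * (g * u) := by linear_combination h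
    exact mul_left_cancel₀ (pow_ne_zero 2 hb) this
  have h2 : e * e ∣ g := by
    obtain ⟨v, hv⟩ := hu.exists_right_inv
    exact ⟨v, by rw [h1, mul_assoc, hv, mul_one]⟩
  have h3 := hg e h2
  exact isUnit_of_mul_isUnit_left (h1 ▸ h3.mul h3)

open Polynomial in
/-- The nonvanishing of the auxiliary polynomial: `A + g ^ (h + 1) * B` at `Y = X ^ R`, where
`R = 2 * h + 1`, is zero only if `A` and `B` are. Since `g ^ (R + 1) = g * g(X ^ R)`, squaring gives
an identity that lifts to `A ^ 2 = g(X) * g(Y) * B ^ 2` in two variables, because the degrees in `X`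
stay below `R`. Comparing leading coefficients in `Y` then contradicts that `g` is squarefree. -/
theorem Polynomial.eq_zero_of_eval_add_mul_eval_eq_zero {K : Type*} [Field K] {g : K[X]}
    (hsq : Squarefree g) {e h : ℕ} (he : 0 < e) (hdeg : g.natDegree = 2 * e)
    (hexp : g ^ (2 * h + 1) = expand K (2 * h + 1) g) (heh : e ≤ h)
    {A B : K[X][X]} (hA : ∀ j, (A.coeff j).natDegree ≤ h)
    (hB : ∀ j, (B.coeff j).natDegree ≤ h - e)
    (hAB : A.eval (X ^ (2 * h + 1)) + g ^ (h + 1) * B.eval (X ^ (2 * h + 1)) = 0) :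
    A = 0 ∧ B = 0 := by
  have hg0 : g ≠ 0 := fun h0 => by rw [h0, natDegree_zero] at hdeg; omega
  have hD : A ^ 2 - C g * g.map C * B ^ 2 = 0 := by
    apply eq_zero_of_eval_X_pow_eq_zero (R := 2 * h + 1)
    · intro j
      refine lt_of_le_of_lt (degree_le_of_natDegree_le (n := 2 * h) ?_) (by norm_cast; omega)
      rw [coeff_sub]
      refine (natDegree_sub_le _ _).trans (max_le ?_ ?_)
      · rw [sq, Polynomial.coeff_mul]
        refine natDegree_sum_le_of_forall_le _ _ fun x _ => natDegree_mul_le.trans ?_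
        have := hA x.1; have := hA x.2; omega
      · rw [mul_assoc, coeff_C_mul]
        refine natDegree_mul_le.trans ?_
        rw [hdeg, coeff_mul]
        have : (∑ x ∈ Finset.HasAntidiagonal.antidiagonal j,
            (g.map C).coeff x.1 * (B ^ 2).coeff x.2).natDegree ≤ 2 * (h - e) := by
          refine natDegree_sum_le_of_forall_le _ _ fun x _ => ?_
          rw [coeff_map]
          refine (natDegree_C_mul_le _ _).trans ?_
          rw [sq, Polynomial.coeff_mul]
          refine natDegree_sum_le_of_forall_le _ _ fun y _ => natDegree_mul_le.trans ?_
          have := hB y.1; have := hB y.2; omega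
        omega
    · have h1 : eval (X ^ (2 * h + 1)) (g.map C) = g ^ (2 * h + 1) := by
        rw [hexp, eval_map, expand_eq_sum]; rw [eval₂_eq_sum]
      rw [eval_sub, eval_mul, eval_mul, eval_pow, eval_pow, eval_C, h1]
      linear_combination (A.eval (X ^ (2 * h + 1)) - g ^ (h + 1) * B.eval (X ^ (2 * h + 1))) * hAB
  have hB0 : B = 0 := by
    by_contra hB0
    have h1 := congrArg leadingCoeff (sub_eq_zero.1 hD)
    rw [leadingCoeff_pow, leadingCoeff_mul, leadingCoeff_mul, leadingCoeff_pow, leadingCoeff_C,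
      leadingCoeff_map_of_injective C_injective] at h1
    have h2 := hsq.isUnit_of_mul_sq_eq_sq
      (isUnit_C.2 (isUnit_iff_ne_zero.2 (leadingCoeff_ne_zero.2 hg0)))
      (leadingCoeff_ne_zero.2 hB0) h1
    have := natDegree_eq_zero_of_isUnit h2
    omega
  refine ⟨?_, hB0⟩
  rw [hB0] at hD
  simpa using hD

open Polynomial in
/-- Let `R = 2 * h + 1`. Over a field of order `R ^ 2`, and for `g` with coefficients fixed by
`x ↦ x ^ R`, the identity in the conclusion makes
`∑ j, (A j + B j * g ^ (h + 1)) * X ^ (R * j)` vanish wherever `g` takes a nonsquare value. The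
identity is a homogeneous linear system in the coefficients of `A j` and `B j`, and taking
`h + 2 * e` values of `j` makes the unknowns outnumber the equations. -/
theorem Polynomial.exists_ne_zero_expand_sub_eq_zero {K : Type*} [Field K] {g : K[X]}
    {e h : ℕ} (hdeg : g.natDegree = 2 * e) (he : 0 < e) (heh : e ≤ h) :
    ∃ A B : Fin (h + 2 * e) → K[X], (A ≠ 0 ∨ B ≠ 0) ∧
      (∀ j, (A j).natDegree ≤ h) ∧ (∀ j, (B j).natDegree ≤ h - e) ∧
      ∑ j, (expand K (2 * h + 1) (A j) - expand K (2 * h + 1) (B j) * g ^ (h + 1)) * X ^ (j : ℕ)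
        = 0 := by
  set J := h + 2 * e with hJ
  set R := 2 * h + 1 with hR
  let Φ : ((Fin J → degreeLT K (h + 1)) × (Fin J → degreeLT K (h - e + 1))) →ₗ[K] K[X] :=
    { toFun := fun v => ∑ j, (expand K R (v.1 j : K[X]) -
        expand K R (v.2 j : K[X]) * g ^ (h + 1)) * X ^ (j : ℕ)
      map_add' := fun v w => by
        rw [← Finset.sum_add_distrib]
        refine Finset.sum_congr rfl fun j _ => ?_
        simp only [Prod.fst_add, Prod.snd_add, Pi.add_apply, Submodule.coe_add, _root_.map_add]
        ring
      map_smul' := fun c v => by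
        rw [RingHom.id_apply, Finset.smul_sum]
        refine Finset.sum_congr rfl fun j _ => ?_
        simp only [Prod.smul_fst, Prod.smul_snd, Pi.smul_apply, SetLike.val_smul, _root_.map_smul]
        simp only [smul_eq_C_mul]
        ring }
  have hlt : ∀ {n} (P : degreeLT K (n + 1)), (P : K[X]).natDegree ≤ n := fun {n} P => by
    by_cases hP : (P : K[X]) = 0
    · simp [hP]
    · exact Nat.lt_succ_iff.1 ((natDegree_lt_iff_degree_lt hP).2 (mem_degreeLT.1 P.2))
  have hΦ : ∀ v, Φ v ∈ degreeLT K (R * h + e + J) := by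
    intro v
    have hv : Φ v = ∑ j, (expand K R (v.1 j : K[X]) -
        expand K R (v.2 j : K[X]) * g ^ (h + 1)) * X ^ (j : ℕ) := rfl
    rw [hv]
    refine Submodule.sum_mem (degreeLT K (R * h + e + J)) fun j _ => mem_degreeLT.2 ?_
    have hA := hlt (v.1 j)
    have hB := hlt (v.2 j)
    have h1 : ((expand K R (v.1 j : K[X]) - expand K R (v.2 j : K[X]) * g ^ (h + 1)) *
        X ^ (j : ℕ)).natDegree ≤ R * h + e + j := by
      refine natDegree_mul_le.trans (add_le_add ?_ (natDegree_X_pow_le _))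
      refine (natDegree_sub_le _ _).trans (max_le ?_ (natDegree_mul_le.trans ?_))
      · rw [natDegree_expand, mul_comm]
        exact (Nat.mul_le_mul_left R hA).trans (Nat.le_add_right _ _)
      · rw [natDegree_expand, natDegree_pow, hdeg]
        have hBe : (v.2 j : K[X]).natDegree + e ≤ h := by omega
        have := Nat.mul_le_mul_right R hBe
        have hRe : (h + 1) * (2 * e) = e * R + e := by rw [hR]; ring
        nlinarith
    refine lt_of_le_of_lt (degree_le_of_natDegree_le h1) ?_
    have := j.2
    norm_cast
    omega
  have hfin : Module.finrank K (degreeLT K (R * h + e + J)) < 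
      Module.finrank K ((Fin J → degreeLT K (h + 1)) × (Fin J → degreeLT K (h - e + 1))) := by
    have hd : ∀ n, Module.finrank K (degreeLT K n) = n := fun n => by
      rw [(degreeLTEquiv K n).finrank_eq, Module.finrank_fin_fun]
    have : ∀ n, FiniteDimensional K (degreeLT K n) := fun n =>
      (degreeLTEquiv K n).symm.finiteDimensional
    rw [Module.finrank_prod, Module.finrank_pi_fintype, Module.finrank_pi_fintype]
    simp only [hd, Finset.sum_const, Finset.card_univ, Fintype.card_fin, smul_eq_mul]
    obtain ⟨f, rfl⟩ := Nat.exists_eq_add_of_le heh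
    rw [Nat.add_sub_cancel_left, hJ, hR]
    nlinarith [Nat.zero_le (e * f)]
  have : ∀ n, FiniteDimensional K (degreeLT K n) := fun n =>
      (degreeLTEquiv K n).symm.finiteDimensional
  have hker := LinearMap.ker_ne_bot_of_finrank_lt (f := Φ.codRestrict _ hΦ) hfin
  obtain ⟨v, hv, hv0⟩ := (Submodule.ne_bot_iff _).1 hker
  refine ⟨fun j => v.1 j, fun j => v.2 j, ?_, fun j => hlt (v.1 j),
    fun j => hlt (v.2 j), ?_⟩
  · by_contra hcon
    push Not at hcon
    refine hv0 (Prod.ext (_root_.funext fun j => Subtype.ext ?_)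
      (_root_.funext fun j => Subtype.ext ?_))
    · exact _root_.congrFun hcon.1 j
    · exact _root_.congrFun hcon.2 j
  · exact congrArg Subtype.val (LinearMap.mem_ker.1 hv)

open Polynomial Classical in
/-- Bombieri's form of Stepanov's bound for the hyperelliptic curve `y ^ 2 = g(z)` over a field whose
order is a square `R ^ 2`, `R = 2 * h + 1`: `g` takes nonsquare values at most `R ^ 2 / 2 + O(R)`
times. The hypothesis `hexp` says that the coefficients of `g` are fixed by `x ↦ x ^ R`. -/
theorem FiniteField.two_mul_card_pow_eq_neg_one_le {K : Type*} [Field K] [Fintype K] {g : K[X]}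
    (hsq : Squarefree g) {e h : ℕ} (he : 0 < e) (hdeg : g.natDegree = 2 * e)
    (hcard : Fintype.card K = (2 * h + 1) ^ 2)
    (hexp : g ^ (2 * h + 1) = expand K (2 * h + 1) g) (heh : e ≤ h) :
    2 * (Finset.univ.filter fun z : K => g.eval z ^ (Fintype.card K / 2) = -1).card ≤
      (2 * h + 1) ^ 2 + 6 * e * (2 * h + 1) := by
  set R := 2 * h + 1 with hR
  set J := h + 2 * e with hJ
  obtain ⟨A, B, hne, hA, hB, hsum⟩ :=
    exists_ne_zero_expand_sub_eq_zero hdeg he heh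
  rw [← hR] at hsum
  set H : K[X] := ∑ j, (A j + B j * g ^ (h + 1)) * X ^ (R * (j : ℕ)) with hH
  have hH0 : H ≠ 0 := by
    intro hzero
    have hcoef : ∀ (P : Fin J → K[X]) (n : ℕ), (∑ j : Fin J, monomial (j : ℕ) (P j)).coeff n =
        if hn : n < J then P ⟨n, hn⟩ else 0 := by
      intro P n
      simp only [finsetSum_coeff, coeff_monomial]
      split_ifs with hn
      · rw [Finset.sum_eq_single ⟨n, hn⟩]
        · simp
        · intro b _ hb
          rw [if_neg]
          intro h'; exact hb (Fin.ext h')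
        · simp
      · exact Finset.sum_eq_zero fun j _ => if_neg (by have := j.2; omega)
    have hev : ∀ P : Fin J → K[X], (∑ j : Fin J, monomial (j : ℕ) (P j)).eval (X ^ R) =
        ∑ j, P j * X ^ (R * (j : ℕ)) := by
      intro P
      simp only [eval_finsetSum, eval_monomial, ← pow_mul]
    obtain ⟨h1, h2⟩ := eq_zero_of_eval_add_mul_eval_eq_zero hsq he hdeg hexp heh
      (A := ∑ j : Fin J, monomial (j : ℕ) (A j)) (B := ∑ j : Fin J, monomial (j : ℕ) (B j))
      (fun n => by
        rw [hcoef]; split_ifs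
        · exact hA _
        · simp)
      (fun n => by
        rw [hcoef]; split_ifs
        · exact hB _
        · simp)
      (by
        rw [hev, hev, ← hzero, hH, Finset.mul_sum, ← Finset.sum_add_distrib]
        exact Finset.sum_congr rfl fun j _ => by ring)
    refine hne.elim (fun h => h (_root_.funext fun j => ?_)) (fun h => h (_root_.funext fun j => ?_))
    · have := hcoef A j
      rw [h1, dif_pos j.2] at this
      simpa using this.symm
    · have := hcoef B j
      rw [h2, dif_pos j.2] at this
      simpa using this.symm
  have hHdeg : H.natDegree ≤ h + e * R + (J - 1) * R := by
    refine natDegree_sum_le_of_forall_le _ _ fun j _ => natDegree_mul_le.trans (add_le_add ?_ ?_)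
    · refine (natDegree_add_le _ _).trans (max_le ((hA j).trans (Nat.le_add_right _ _)) ?_)
      refine natDegree_mul_le.trans ?_
      rw [natDegree_pow, hdeg]
      have := hB j
      obtain ⟨f, rfl⟩ := Nat.exists_eq_add_of_le heh
      rw [Nat.add_sub_cancel_left] at this
      rw [hR]
      nlinarith
    · refine (natDegree_X_pow_le _).trans ?_
      rw [mul_comm]
      exact Nat.mul_le_mul_right _ (by have := j.2; omega)
  have hroots : ∀ w : K, g.eval w ^ (Fintype.card K / 2) = -1 → H.eval w = 0 := by
    intro w hw
    -- Evaluate the identity at `w ^ R`: there `g ^ (h + 1)` takes the value `-g(w) ^ (h + 1)`, since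
    -- `R * (h + 1) = (R ^ 2 - 1) / 2 + (h + 1)`, and `(w ^ R) ^ R = w`.
    have hfrob : ∀ z : K, g.eval (z ^ R) = g.eval z ^ R := fun z => by
      rw [← expand_eval, ← hexp, eval_pow]
    have hwR : (w ^ R) ^ R = w := by
      rw [← pow_mul, ← sq, ← hcard, FiniteField.pow_card]
    have hq2 : Fintype.card K / 2 = 2 * h * (h + 1) := by
      rw [hcard, show (R : ℕ) ^ 2 = 1 + 2 * (2 * h * (h + 1)) by rw [hR]; ring]
      omega
    have hg : g.eval (w ^ R) ^ (h + 1) = -(g.eval w ^ (h + 1)) := by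
      rw [hfrob, ← pow_mul, show R * (h + 1) = Fintype.card K / 2 + (h + 1) by
        rw [hq2, hR]; ring, pow_add, hw, neg_one_mul]
    have h1 := congrArg (eval (w ^ R)) hsum
    rw [eval_finsetSum, eval_zero] at h1
    rw [hH, eval_finsetSum, ← h1]
    refine Finset.sum_congr rfl fun j _ => ?_
    simp only [eval_mul, eval_add, eval_sub, eval_pow, eval_X, expand_eval, hg, hwR, pow_mul]
    ring
  have hcardle : (Finset.univ.filter fun z : K => g.eval z ^ (Fintype.card K / 2) = -1).card ≤
      H.natDegree := by
    refine (Finset.card_le_card fun z hz => ?_).trans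
      ((Multiset.toFinset_card_le H.roots).trans (card_roots' H))
    rw [Multiset.mem_toFinset, mem_roots hH0]
    exact hroots z (Finset.mem_filter.1 hz).2
  obtain ⟨f, hf⟩ : ∃ f, J = f + 1 := ⟨J - 1, by omega⟩
  have h2 := hcardle.trans hHdeg
  rw [hf, Nat.add_sub_cancel] at h2
  have h3 : f = h + 2 * e - 1 := by omega
  have h4 : f + 1 = h + 2 * e := by omega
  have h5 : f * R + R = h * R + 2 * e * R := by rw [← Nat.succ_mul, ← add_mul]; rw [← h4]
  have h6 : R ^ 2 = 2 * (h * R) + R := by rw [hR]; ring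
  have h7 : 2 * h ≤ R := by omega
  rw [h6]
  nlinarith

/-! ### Sums over conics and quadratic extensions -/

theorem FiniteField.ringChar_ne_two_of_odd_card {K : Type*} [Field K] [Fintype K]
    (hK : Odd (Fintype.card K)) : ringChar K ≠ 2 := fun h =>
  Nat.not_even_iff_odd.2 hK (Nat.even_iff.2 (FiniteField.even_card_of_char_two h))

theorem FiniteField.two_ne_zero_of_odd_card {K : Type*} [Field K] [Fintype K]
    (hK : Odd (Fintype.card K)) : (2 : K) ≠ 0 :=
  Ring.two_ne_zero (FiniteField.ringChar_ne_two_of_odd_card hK)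

section

variable {K : Type*} [Field K] [Fintype K] [DecidableEq K]

/-- The sum `∑ t, ψ t * η (c - t ^ 2)`, where `η` is the quadratic character of `K`. For `ψ ≠ 1`
and `c = u ^ 2 + v ^ 2 ≠ 0` it is the Fourier coefficient of the circle at the frequency `(u, v)`, see
`circleSum_eq_conicSum`. -/
noncomputable def conicSum (c : K) (ψ : AddChar K ℂ) : ℂ :=
  ∑ t, ψ t * (quadraticChar K (c - t ^ 2) : ℂ)

/-- Each `y` is a square in `1 + η y` ways. -/
theorem sum_comp_sq (hK : Odd (Fintype.card K)) (f : K → ℂ) :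
    ∑ t, f (t ^ 2) = ∑ y, (1 + (quadraticChar K y : ℂ)) * f y := by
  rw [← Finset.sum_fiberwise_of_maps_to (s := Finset.univ) (t := Finset.univ)
    (g := fun t : K => t ^ 2)
    (fun _ _ => Finset.mem_univ _)]
  refine Finset.sum_congr rfl fun y _ => ?_
  rw [Finset.sum_congr rfl (g := fun _ => f y) (fun t ht => by rw [(Finset.mem_filter.1 ht).2]),
    Finset.sum_const, nsmul_eq_mul]
  congr 1
  have h := quadraticChar_card_sqrts (FiniteField.ringChar_ne_two_of_odd_card hK) y
  have h2 : {x : K | x ^ 2 = y}.toFinset = Finset.univ.filter fun t : K => t ^ 2 = y := by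
    ext; simp
  rw [h2] at h
  rw [← Int.cast_natCast, h]
  push_cast
  ring

/-- After removing the square the sum becomes the Jacobi sum of `η` with itself. -/
theorem sum_quadraticChar_sq_sub (hK : Odd (Fintype.card K)) {c : K} (hc : c ≠ 0) :
    ∑ t, (quadraticChar K (t ^ 2 - c) : ℂ) = -1 := by
  have h2 := FiniteField.ringChar_ne_two_of_odd_card hK
  rw [sum_comp_sq hK (fun y => (quadraticChar K (y - c) : ℂ))]
  have h0 : ∑ y, (quadraticChar K (y - c) : ℂ) = 0 := by
    have := Equiv.sum_comp (Equiv.subRight c) (fun y => quadraticChar K y)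
    rw [quadraticChar_sum_zero h2] at this
    exact_mod_cast this
  simp only [add_mul, one_mul, Finset.sum_add_distrib]
  rw [h0, zero_add]
  have hJ := jacobiSum_nontrivial_inv (quadraticChar_ne_one h2)
  rw [(quadraticChar_isQuadratic K).inv] at hJ
  have hsq : ∀ a : K, a ≠ 0 → quadraticChar K a * quadraticChar K a = 1 := fun a ha => by
    rw [← sq, quadraticChar_sq_one ha]
  have h3 : ∑ y, quadraticChar K y * quadraticChar K (y - c) = -1 := by
    rw [← Equiv.sum_comp (Equiv.mulLeft₀ c hc)]
    have : ∀ z : K, quadraticChar K (c * z) * quadraticChar K (c * z - c) =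
        quadraticChar K (-1) * (quadraticChar K z * quadraticChar K (1 - z)) := fun z => by
      rw [show c * z - c = c * (-1) * (1 - z) by ring, map_mul, map_mul, map_mul]
      linear_combination quadraticChar K (-1) * quadraticChar K z * quadraticChar K (1 - z)
        * hsq c hc
    simp only [Equiv.mulLeft₀_apply, this]
    rw [← Finset.mul_sum]
    change _ * jacobiSum _ _ = _
    rw [hJ, mul_neg, hsq _ (neg_ne_zero.2 one_ne_zero)]
  exact_mod_cast h3

theorem sum_addChar_mul_sum_quadraticChar (hK : Odd (Fintype.card K)) {c : K} (hc : c ≠ 0)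
    {ψ : AddChar K ℂ} (hψ : ψ ≠ 1) :
    ∑ S, ∑ M, ψ S * (quadraticChar K ((c + M) ^ 2 - c * S ^ 2) : ℂ) = Fintype.card K := by
  have h1 : ∀ S : K, ∑ M, ψ S * (quadraticChar K ((c + M) ^ 2 - c * S ^ 2) : ℂ) =
      -ψ S + if S = 0 then (Fintype.card K : ℂ) else 0 := by
    intro S
    have hshift := Equiv.sum_comp (Equiv.addLeft c)
      (fun M => (quadraticChar K (M ^ 2 - c * S ^ 2) : ℂ))
    simp only [Equiv.coe_addLeft] at hshift
    rw [← Finset.mul_sum, hshift]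
    split_ifs with hS
    · have : ∀ M : K, (quadraticChar K (M ^ 2 - c * S ^ 2) : ℂ) = 1 - if M = 0 then 1 else 0 := by
        intro M
        rw [hS]
        split_ifs with hM
        · simp [hM]
        · rw [show M ^ 2 - c * 0 ^ 2 = M ^ 2 by ring, quadraticChar_sq_one' hM]; simp
      rw [Finset.sum_congr rfl fun M _ => this M, Finset.sum_sub_distrib, Finset.sum_ite_eq', hS]
      simp
      ring
    · rw [sum_quadraticChar_sq_sub hK (mul_ne_zero hc (pow_ne_zero 2 hS))]
      ring
  simp only [h1, Finset.sum_add_distrib, Finset.sum_neg_distrib,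
    AddChar.sum_eq_zero_of_ne_one hψ, Finset.sum_ite_eq', Finset.mem_univ, if_true]
  simp

/-- Substitution of `M = (S ^ 2 - μ * d ^ 2) / 4` for `d`. With `S` as trace and `M` as norm, this
counts the elements of `K × K` (for `μ = 1`) or of the quadratic field extension of `K` (for `μ` a
nonsquare) with given trace and norm. -/
theorem sum_sum_comp_sq_sub_mul_sq (hK : Odd (Fintype.card K)) {μ : K} (hμ : μ ≠ 0)
    (g : K → K → ℂ) :
    ∑ S, ∑ d, g S ((S ^ 2 - μ * d ^ 2) / 4) =
      ∑ S, ∑ M, (1 + (quadraticChar K μ : ℂ) * (quadraticChar K (S ^ 2 - 4 * M) : ℂ)) * g S M := by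
  have h2 := FiniteField.two_ne_zero_of_odd_card hK
  have h4 : (4 : K) ≠ 0 := by
    rw [show (4 : K) = 2 * 2 by norm_num]; exact mul_ne_zero h2 h2
  refine Finset.sum_congr rfl fun S _ => ?_
  rw [sum_comp_sq hK (fun y => g S ((S ^ 2 - μ * y) / 4))]
  let E : K ≃ K :=
    { toFun := fun M => (S ^ 2 - 4 * M) / μ
      invFun := fun y => (S ^ 2 - μ * y) / 4
      left_inv := fun M => by field_simp; ring
      right_inv := fun y => by field_simp; ring }
  rw [← E.sum_comp]
  refine Finset.sum_congr rfl fun M _ => ?_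
  have hE : E M = (S ^ 2 - 4 * M) / μ := rfl
  have hμ2 : (S ^ 2 - 4 * M) / μ = μ * (S ^ 2 - 4 * M) * (μ⁻¹) ^ 2 := by field_simp
  rw [hE]
  congr 2
  · rw [hμ2, map_mul, quadraticChar_sq_one' (inv_ne_zero hμ), map_mul]
    push_cast
    ring
  · field_simp
    ring

/-- The square of the sum, grouped by `S = s + t` and `M = s * t`. -/
theorem conicSum_sq (hK : Odd (Fintype.card K)) (c : K) (ψ : AddChar K ℂ) :
    conicSum c ψ ^ 2 = ∑ S, ∑ M, (1 + (quadraticChar K (S ^ 2 - 4 * M) : ℂ)) *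
      (ψ S * (quadraticChar K ((c + M) ^ 2 - c * S ^ 2) : ℂ)) := by
  have h2 := FiniteField.two_ne_zero_of_odd_card hK
  have h := sum_sum_comp_sq_sub_mul_sq hK one_ne_zero
    (fun S M => ψ S * (quadraticChar K ((c + M) ^ 2 - c * S ^ 2) : ℂ))
  simp only [map_one, Int.cast_one, one_mul] at h
  rw [← h, sq, conicSum, Finset.sum_mul_sum, ← Fintype.sum_prod_type', ← Fintype.sum_prod_type']
  let E : K × K ≃ K × K :=
    { toFun := fun x => (x.1 + x.2, x.1 - x.2)
      invFun := fun x => ((x.1 + x.2) / 2, (x.1 - x.2) / 2)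
      left_inv := fun x => by ext <;> (field_simp; ring)
      right_inv := fun x => by ext <;> (field_simp; ring) }
  refine Eq.trans ?_ (Equiv.sum_comp E _)
  refine Finset.sum_congr rfl fun x _ => ?_
  obtain ⟨s, t⟩ := x
  have hE : E (s, t) = (s + t, s - t) := rfl
  rw [hE]
  simp only
  have h4 : (4 : K) ≠ 0 := by
    rw [show (4 : K) = 2 * 2 by norm_num]; exact mul_ne_zero h2 h2
  have hM : ((s + t) ^ 2 - (s - t) ^ 2) / 4 = s * t := by field_simp; ring
  rw [hM, AddChar.map_add_eq_mul,
    show (c + s * t) ^ 2 - c * (s + t) ^ 2 = (c - s ^ 2) * (c - t ^ 2) by ring, map_mul]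
  push_cast
  ring

/-- The sum is real, by the symmetry `t ↦ -t`. -/
theorem conicSum_re (c : K) (ψ : AddChar K ℂ) : ((conicSum c ψ).re : ℂ) = conicSum c ψ := by
  rw [← Complex.conj_eq_iff_re]
  rw [conicSum, map_sum, ← Equiv.sum_comp (Equiv.neg K)]
  refine Finset.sum_congr rfl fun t _ => ?_
  rw [map_mul, Equiv.neg_apply, ← AddChar.map_neg_eq_conj, neg_neg, neg_sq]
  congr 1
  simp

theorem conicSum_one (hK : Odd (Fintype.card K)) {c : K} (hc : c ≠ 0) :
    conicSum c 1 = -(quadraticChar K (-1) : ℂ) := by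
  have : ∀ t : K, (1 : AddChar K ℂ) t * (quadraticChar K (c - t ^ 2) : ℂ) =
      (quadraticChar K (-1) : ℂ) * (quadraticChar K (t ^ 2 - c) : ℂ) := fun t => by
    rw [show c - t ^ 2 = -1 * (t ^ 2 - c) by ring, map_mul, AddChar.one_apply]
    push_cast
    ring
  rw [conicSum]
  simp only [this]
  rw [← Finset.mul_sum, sum_quadraticChar_sq_sub hK hc, mul_neg_one]

end

namespace QuadraticAlgebra

variable {K : Type*} [Field K] [Fintype K] [DecidableEq K] {ν : K}

instance : Fintype (QuadraticAlgebra K ν 0) := Fintype.ofEquiv _ (equivProd ν 0).symm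

instance : DecidableEq (QuadraticAlgebra K ν 0) := (equivProd ν 0).decidableEq

omit [DecidableEq K] in
theorem fintype_card : Fintype.card (QuadraticAlgebra K ν 0) = Fintype.card K ^ 2 := by
  rw [Fintype.card_congr (equivProd ν 0), Fintype.card_prod, sq]

omit [DecidableEq K] in
theorem sum_eq_sum_sum {M : Type*} [AddCommMonoid M] (f : QuadraticAlgebra K ν 0 → M) :
    ∑ z, f z = ∑ u, ∑ v, f ⟨u, v⟩ := by
  rw [← (equivProd ν 0).symm.sum_comp, Fintype.sum_prod_type]
  rfl

variable [hν : Fact (∀ r : K, r ^ 2 ≠ ν + 0 * r)]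

theorem quadraticChar_eq_neg_one : quadraticChar K ν = -1 := by
  rw [quadraticChar_neg_one_iff_not_isSquare]
  rintro ⟨r, hr⟩
  exact hν.out r (by rw [hr]; ring)

theorem pow_card_eq_star (hK : Odd (Fintype.card K)) (z : QuadraticAlgebra K ν 0) :
    z ^ Fintype.card K = star z := by
  have hω : (ω : QuadraticAlgebra K ν 0) ^ Fintype.card K = -ω := by
    have h1 := quadraticChar_eq_pow_of_char_ne_two' (FiniteField.ringChar_ne_two_of_odd_card hK) ν
    rw [quadraticChar_eq_neg_one] at h1
    have h2 : (ω : QuadraticAlgebra K ν 0) ^ 2 = algebraMap K _ ν := by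
      rw [sq, omega_mul_omega_eq_mk, algebraMap_eq]
    obtain ⟨m, hm⟩ := hK
    rw [hm, show (2 * m + 1) / 2 = m by omega] at h1
    rw [hm, pow_succ, pow_mul, h2, ← map_pow, ← h1]
    simp
  have h3 := congrArg (FiniteField.frobeniusAlgHom K (QuadraticAlgebra K ν 0))
    (mk_eq_add_smul_omega (a := ν) (b := 0) z.re z.im)
  simp only [map_add, map_smul, FiniteField.coe_frobeniusAlgHom, AlgHom.commutes] at h3
  rw [hω] at h3
  refine h3.trans ?_
  ext <;> simp

theorem quadraticChar_eq_norm (hK : Odd (Fintype.card K)) (z : QuadraticAlgebra K ν 0) :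
    quadraticChar (QuadraticAlgebra K ν 0) z = quadraticChar K z.norm := by
  have hL : Odd (Fintype.card (QuadraticAlgebra K ν 0)) := by rw [fintype_card]; exact hK.pow
  have h1 := quadraticChar_eq_pow_of_char_ne_two'
    (FiniteField.ringChar_ne_two_of_odd_card hK) z.norm
  have h2 := quadraticChar_eq_pow_of_char_ne_two'
    (FiniteField.ringChar_ne_two_of_odd_card hL) z
  have h3 : z ^ (Fintype.card (QuadraticAlgebra K ν 0) / 2) =
      algebraMap K _ (z.norm ^ (Fintype.card K / 2)) := by
    rw [map_pow, algebraMap_norm_eq_mul_star, ← pow_card_eq_star hK, ← pow_succ', ← pow_mul,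
      fintype_card]
    obtain ⟨m, hm⟩ := hK
    rw [hm, show (2 * m + 1) / 2 = m by omega,
      show (2 * m + 1) ^ 2 = 1 + 2 * ((2 * m + 1 + 1) * m) by ring]
    congr 1
    omega
  rw [← h2, ← h1, map_intCast] at h3
  by_cases hz : z = 0
  · simp [hz]
  have hn : z.norm ≠ 0 := by rwa [Ne, norm_eq_zero_iff_eq_zero]
  have hne := Ring.neg_one_ne_one_of_char_ne_two (FiniteField.ringChar_ne_two_of_odd_card hL)
  rcases quadraticChar_dichotomy hz with h | h <;> rcases quadraticChar_dichotomy hn with h' | h' <;>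
    rw [h, h'] at h3 ⊢
  · exact absurd (by simpa using h3.symm) hne
  · exact absurd (by simpa using h3) hne

/-- The Davenport–Hasse type relation for a quadratic extension. Grouped by trace `S` and norm `M`,
the left side and `conicSum c ψ ^ 2` are sums of the same terms with the complementary weights
`1 - η (S ^ 2 - 4 * M)` and `1 + η (S ^ 2 - 4 * M)`. -/
theorem conicSum_eq (hK : Odd (Fintype.card K)) {c : K} (hc : c ≠ 0)
    {ψ : AddChar K ℂ} (hψ : ψ ≠ 1) :
    conicSum (algebraMap K (QuadraticAlgebra K ν 0) c)
        (ψ.compAddMonoidHom (trace : QuadraticAlgebra K ν 0 →ₗ[K] K).toAddMonoidHom) =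
      2 * Fintype.card K - conicSum c ψ ^ 2 := by
  have h2 := FiniteField.two_ne_zero_of_odd_card hK
  have h4 : (4 : K) ≠ 0 := by
    rw [show (4 : K) = 2 * 2 by norm_num]; exact mul_ne_zero h2 h2
  have hν0 : ν ≠ 0 := fun h => hν.out 0 (by rw [h]; ring)
  rw [eq_sub_iff_add_eq, conicSum_sq hK, ← sum_addChar_mul_sum_quadraticChar hK hc hψ]
  have h := sum_sum_comp_sq_sub_mul_sq hK hν0
    (fun S M => ψ S * (quadraticChar K ((c + M) ^ 2 - c * S ^ 2) : ℂ))
  rw [quadraticChar_eq_neg_one] at h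
  have hL : conicSum (algebraMap K (QuadraticAlgebra K ν 0) c)
        (ψ.compAddMonoidHom (trace : QuadraticAlgebra K ν 0 →ₗ[K] K).toAddMonoidHom) =
      ∑ S, ∑ d, ψ S * (quadraticChar K ((c + (S ^ 2 - ν * d ^ 2) / 4) ^ 2 - c * S ^ 2) : ℂ) := by
    rw [conicSum, sum_eq_sum_sum, ← Equiv.sum_comp (Equiv.mulLeft₀ (2 : K) h2)
      (fun S => ∑ d, ψ S * _)]
    refine Finset.sum_congr rfl fun u _ => ?_
    rw [← Equiv.sum_comp (Equiv.mulLeft₀ (2 : K) h2) (fun d => ψ _ * _)]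
    refine Finset.sum_congr rfl fun v _ => ?_
    rw [quadraticChar_eq_norm hK]
    have htr : (trace : QuadraticAlgebra K ν 0 →ₗ[K] K) ⟨u, v⟩ = 2 * u := by simp [trace_def]
    have hn : norm (algebraMap K (QuadraticAlgebra K ν 0) c - ⟨u, v⟩ ^ 2) =
        (c + ((2 * u) ^ 2 - ν * (2 * v) ^ 2) / 4) ^ 2 - c * (2 * u) ^ 2 := by
      rw [norm_def]
      simp [sq]
      field_simp
      ring
    rw [AddChar.compAddMonoidHom_apply, LinearMap.toAddMonoidHom_coe, htr, hn]
    rfl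
  rw [hL, h, ← Finset.sum_add_distrib, Finset.mul_sum]
  refine Finset.sum_congr rfl fun S _ => ?_
  rw [← Finset.sum_add_distrib, Finset.mul_sum]
  refine Finset.sum_congr rfl fun M _ => ?_
  push_cast
  ring

end QuadraticAlgebra

/-! ### The tower of quadratic extensions -/

theorem FiniteField.add_pow_card_of_ringHom {F L : Type*} [Field F] [Fintype F] [CommRing L]
    (ι : F →+* L) (a b : L) :
    (a + b) ^ Fintype.card F = a ^ Fintype.card F + b ^ Fintype.card F := by
  let := ι.toAlgebra
  exact map_add (FiniteField.frobeniusAlgHom F L) a b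

theorem AddChar.compAddMonoidHom_ne_one {A B M : Type*} [AddMonoid A] [AddMonoid B] [CommMonoid M]
    {ψ : AddChar B M} (hψ : ψ ≠ 1) {τ : A →+ B} (hτ : Function.Surjective τ) :
    ψ.compAddMonoidHom τ ≠ 1 := by
  obtain ⟨b, hb⟩ := AddChar.ne_one_iff.1 hψ
  obtain ⟨a, rfl⟩ := hτ b
  exact AddChar.ne_one_iff.2 ⟨a, hb⟩

universe u

/-- The tower of quadratic extensions. The map `τ` is the trace of the `k`-th field `K` down to `F`.
The last clause is the `k`-fold iteration of `QuadraticAlgebra.conicSum_eq`, normalised by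
`√(#K)` so that the relation reads `x ↦ x ^ 2 - 2`. -/
theorem exists_field_card_pow_two_pow_conicSum {F : Type u} [Field F] [Fintype F] [DecidableEq F]
    (hF : Odd (Fintype.card F)) (k : ℕ) :
    ∃ (K : Type u) (_ : Field K) (_ : Fintype K) (_ : DecidableEq K) (ι : F →+* K) (τ : K →+ F),
      Function.Surjective τ ∧ (∀ z, τ (z ^ Fintype.card F) = τ z) ∧
      Fintype.card K = Fintype.card F ^ 2 ^ k ∧
      ∀ c : F, c ≠ 0 → ∀ ψ : AddChar F ℂ, ψ ≠ 1 →
        conicSum (ι c) (ψ.compAddMonoidHom τ) = -(√(Fintype.card F : ℝ) : ℂ) ^ 2 ^ k *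
          (((fun x : ℝ => x ^ 2 - 2)^[k] (-(conicSum c ψ).re / √(Fintype.card F : ℝ)) : ℝ) : ℂ) := by
  have hq0 : (0 : ℝ) < Fintype.card F := by exact_mod_cast Fintype.card_pos
  have hs : (√(Fintype.card F : ℝ) : ℂ) ^ 2 = Fintype.card F := by
    rw [← Complex.ofReal_pow, Real.sq_sqrt hq0.le, Complex.ofReal_natCast]
  induction k with
  | zero =>
    refine ⟨F, inferInstance, inferInstance, inferInstance, RingHom.id F, AddMonoidHom.id F,
      Function.surjective_id, fun z => ?_, by simp, fun c _ ψ _ => ?_⟩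
    · simp [FiniteField.pow_card]
    · have hne : (√(Fintype.card F : ℝ) : ℂ) ≠ 0 := by
        rw [Ne, Complex.ofReal_eq_zero]; exact (Real.sqrt_pos.2 hq0).ne'
      have h1 : ψ.compAddMonoidHom (AddMonoidHom.id F) = ψ := by ext; simp
      rw [h1, RingHom.id_apply, pow_zero, pow_one, Function.iterate_zero, id]
      push_cast
      rw [conicSum_re]
      field_simp
  | succ k ih =>
    obtain ⟨K, _, _, _, ι, τ, hτ, hτq, hcard, hsum⟩ := ih
    have hK : Odd (Fintype.card K) := by rw [hcard]; exact hF.pow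
    obtain ⟨ν, hν⟩ := quadraticChar_exists_neg_one (FiniteField.ringChar_ne_two_of_odd_card hK)
    have : Fact (∀ r : K, r ^ 2 ≠ ν + 0 * r) := ⟨fun r hr => by
      rw [quadraticChar_neg_one_iff_not_isSquare] at hν
      exact hν ⟨r, by rw [← sq, hr]; ring⟩⟩
    let tr : QuadraticAlgebra K ν 0 →+ K :=
      (QuadraticAlgebra.trace : QuadraticAlgebra K ν 0 →ₗ[K] K).toAddMonoidHom
    have htr : ∀ z, tr z = QuadraticAlgebra.trace z := fun _ => rfl
    have h2 := FiniteField.two_ne_zero_of_odd_card hK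
    refine ⟨QuadraticAlgebra K ν 0, inferInstance, inferInstance, inferInstance,
      (algebraMap K _).comp ι, τ.comp tr, ?_, fun z => ?_, ?_, fun c hc ψ hψ => ?_⟩
    · refine hτ.comp fun r => ⟨algebraMap K _ (r / 2), ?_⟩
      rw [htr, QuadraticAlgebra.trace_algebraMap]
      field_simp
    · rw [AddMonoidHom.comp_apply, AddMonoidHom.comp_apply, ← hτq (tr z)]
      congr 1
      apply QuadraticAlgebra.algebraMap_injective (a := ν) (b := 0)
      rw [htr, htr, map_pow (algebraMap K _), QuadraticAlgebra.algebraMap_trace_eq_add_star,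
        QuadraticAlgebra.algebraMap_trace_eq_add_star, star_pow,
        FiniteField.add_pow_card_of_ringHom ((algebraMap K _).comp ι)]
    · rw [QuadraticAlgebra.fintype_card, hcard, ← pow_mul, ← pow_succ]
    · have hcomp : ψ.compAddMonoidHom (τ.comp tr) = (ψ.compAddMonoidHom τ).compAddMonoidHom tr := rfl
      rw [hcomp, RingHom.comp_apply, QuadraticAlgebra.conicSum_eq hK
        ((map_ne_zero ι).2 hc) (AddChar.compAddMonoidHom_ne_one hψ hτ), hsum c hc ψ hψ, hcard,
        Function.iterate_succ_apply']
      push_cast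
      rw [← hs, ← pow_mul, pow_succ 2 k, pow_mul _ (2 ^ k) 2, mul_comm 2 (2 ^ k), pow_mul]
      ring

open Classical in
/-- The additive form of Hilbert's theorem 90: `z ↦ z ^ q - z` is `q`-to-one onto the kernel of the
trace-like map `τ`. -/
theorem sum_pow_card_sub {F K : Type*} [Field F] [Fintype F] [Field K] [Fintype K]
    {τ : K →+ F} (hτ : Function.Surjective τ) (hτq : ∀ z, τ (z ^ Fintype.card F) = τ z)
    (f : K → ℂ) :
    ∑ z, f (z ^ Fintype.card F - z) =
      Fintype.card F * ∑ t, if τ t = 0 then f t else 0 := by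
  set q := Fintype.card F with hq
  have hq1 : 1 < q := Fintype.one_lt_card
  set N : K → ℕ := fun t => (Finset.univ.filter fun z : K => z ^ q - z = t).card with hN
  have hle : ∀ t ∈ (Finset.univ : Finset K), N t ≤ if τ t = 0 then q else 0 := by
    intro t _
    split_ifs with ht
    · let P : Polynomial K := Polynomial.X ^ q - (Polynomial.X + Polynomial.C t)
      have hdeg : P.natDegree = q := by
        rw [Polynomial.natDegree_sub_eq_left_of_natDegree_lt, Polynomial.natDegree_X_pow]
        rwa [Polynomial.natDegree_X_add_C, Polynomial.natDegree_X_pow]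
      have hP0 : P ≠ 0 := fun h => by rw [h, Polynomial.natDegree_zero] at hdeg; omega
      rw [← hdeg]
      refine (Finset.card_le_card fun z hz => ?_).trans
        ((Multiset.toFinset_card_le P.roots).trans (Polynomial.card_roots' P))
      rw [Multiset.mem_toFinset, Polynomial.mem_roots hP0]
      have := (Finset.mem_filter.1 hz).2
      simp only [P, Polynomial.IsRoot.def, Polynomial.eval_sub, Polynomial.eval_pow,
        Polynomial.eval_X, Polynomial.eval_add, Polynomial.eval_C]
      linear_combination this
    · rw [Nat.le_zero, hN, Finset.card_eq_zero, Finset.filter_eq_empty_iff]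
      intro z _ hz
      rw [← hz, map_sub, hτq, sub_self] at ht
      exact ht rfl
  have hsum1 : ∑ t, N t = Fintype.card K :=
    (Finset.card_eq_sum_card_fiberwise (s := Finset.univ) (t := Finset.univ)
      (f := fun z : K => z ^ q - z) fun _ _ => Finset.mem_coe.2 (Finset.mem_univ _)).symm
  have hsum2 : ∑ t : K, (if τ t = 0 then q else 0) = Fintype.card K := by
    have h1 : Fintype.card K = ∑ a : F, (Finset.univ.filter fun t : K => τ t = a).card :=
      Finset.card_eq_sum_card_fiberwise (s := Finset.univ) (t := Finset.univ)
        (f := fun z : K => τ z) fun _ _ => Finset.mem_coe.2 (Finset.mem_univ _)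
    have h2 : ∀ a : F, (Finset.univ.filter fun t : K => τ t = a).card =
        (Finset.univ.filter fun t : K => τ t = 0).card := fun a =>
      AddMonoidHom.card_fiber_eq_of_mem_range τ (hτ a) (hτ 0)
    rw [h1, Finset.sum_congr rfl fun a _ => h2 a, Finset.sum_const, Finset.card_univ,
      ← Finset.sum_filter, Finset.sum_const, smul_eq_mul, smul_eq_mul, mul_comm]
  -- A fibre over the kernel of `τ` has at most `q` points and the other fibres are empty; the totals
  -- agree, so these bounds are attained.
  have heq := (Finset.sum_eq_sum_iff_of_le hle).1 (hsum1.trans hsum2.symm)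
  rw [← Finset.sum_fiberwise_of_maps_to (s := Finset.univ) (t := Finset.univ)
    (g := fun z : K => z ^ q - z) (fun _ _ => Finset.mem_univ _), Finset.mul_sum]
  refine Finset.sum_congr rfl fun t ht => ?_
  rw [Finset.sum_congr rfl (g := fun _ => f t) (fun z hz => by rw [(Finset.mem_filter.1 hz).2]),
    Finset.sum_const, nsmul_eq_mul]
  change (N t : ℂ) * f t = _
  rw [heq t ht]
  split_ifs <;> simp

theorem sum_conicSum_compAddMonoidHom {F K : Type*} [Field F] [Fintype F] [Field K] [Fintype K]
    [DecidableEq K]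
    {τ : K →+ F} (hτ : Function.Surjective τ) (hτq : ∀ z, τ (z ^ Fintype.card F) = τ z) (c : K) :
    ∑ ψ : AddChar F ℂ, conicSum c (ψ.compAddMonoidHom τ) =
      ∑ z : K, (quadraticChar K (c - (z ^ Fintype.card F - z) ^ 2) : ℂ) := by
  classical
  rw [sum_pow_card_sub hτ hτq (fun t => (quadraticChar K (c - t ^ 2) : ℂ))]
  simp only [conicSum]
  rw [Finset.sum_comm, Finset.mul_sum]
  refine Finset.sum_congr rfl fun t _ => ?_
  simp only [AddChar.compAddMonoidHom_apply]
  rw [← Finset.sum_mul, AddChar.sum_apply_eq_ite]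
  split_ifs <;> simp

open Polynomial in
theorem FiniteField.pow_card_pow_eq_expand {F : Type*} [Field F] [Fintype F] (f : F[X]) (n : ℕ) :
    f ^ Fintype.card F ^ n = expand F (Fintype.card F ^ n) f := by
  induction n with
  | zero => simp
  | succ n ih => rw [pow_succ, pow_mul, ih, ← FiniteField.expand_card, expand_expand, mul_comm]

open Polynomial in
/-- Stepanov's bound for the hyperelliptic curve `y ^ 2 = c - (z ^ q - z) ^ 2`, which has coefficients
in `F`. The term `8 q` is not optimal, but is independent of the extension. -/
theorem neg_le_sum_quadraticChar_sub_sq {F K : Type*} [Field F] [Fintype F]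
    (hF : Odd (Fintype.card F)) [Field K] [Fintype K] [DecidableEq K] (ι : F →+* K) {n : ℕ}
    (hn : 2 ≤ n) (hcard : Fintype.card K = (Fintype.card F ^ n) ^ 2) {c : F} (hc : c ≠ 0) :
    -(8 * Fintype.card F * Fintype.card F ^ n : ℤ) ≤
      ∑ z : K, quadraticChar K (ι c - (z ^ Fintype.card F - z) ^ 2) := by
  classical
  set q := Fintype.card F with hq
  have hq1 : 1 < q := Fintype.one_lt_card
  have hK : Odd (Fintype.card K) := by rw [hcard]; exact hF.pow.pow
  have hK2 := FiniteField.ringChar_ne_two_of_odd_card hK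
  have h2 := FiniteField.two_ne_zero_of_odd_card hF
  obtain ⟨h, hh⟩ : Odd (q ^ n) := hF.pow
  have hqh : q ≤ h := by
    have : q ^ 2 ≤ q ^ n := Nat.pow_le_pow_right hq1.le hn
    obtain ⟨m, hm⟩ := hF
    have : 1 ≤ m := by omega
    nlinarith
  set g₀ : F[X] := C c - (X ^ q - X) ^ 2 with hg₀
  have hdegq : (X ^ q - X : F[X]).natDegree = q := FiniteField.X_pow_card_sub_X_natDegree_eq F hq1
  have hdeg₀ : g₀.natDegree = 2 * q := by
    rw [hg₀, natDegree_sub_eq_right_of_natDegree_lt] <;> rw [natDegree_pow, hdegq]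
    rw [natDegree_C]; omega
  have hsep₀ : g₀.Separable := by
    have hder : derivative g₀ = C 2 * (X ^ q - X) := by
      have hq0 : (q : F[X]) = 0 := by
        rw [← C_eq_natCast, hq, FiniteField.cast_card_eq_zero, C_0]
      rw [hg₀, derivative_sub, derivative_C, derivative_pow, derivative_sub, derivative_X,
        derivative_X_pow]
      simp only [Nat.cast_ofNat, map_ofNat, C_eq_natCast, hq0]
      ring
    refine ⟨C c⁻¹, C (c⁻¹ * 2⁻¹) * (X ^ q - X), ?_⟩
    rw [hder, hg₀]
    have e1 : (C c⁻¹ * C c : F[X]) = 1 := by rw [← C_mul, inv_mul_cancel₀ hc, C_1]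
    have e2 : (C 2⁻¹ * C 2 : F[X]) = 1 := by rw [← C_mul, inv_mul_cancel₀ h2, C_1]
    rw [C_mul]
    linear_combination e1 + C c⁻¹ * (X ^ q - X) ^ 2 * e2
  set g : K[X] := g₀.map ι with hg
  have hgdeg : g.natDegree = 2 * q := by rw [hg, natDegree_map, hdeg₀]
  have hgsq : Squarefree g := (hsep₀.map (f := ι)).squarefree
  have hgev : ∀ z, g.eval z = ι c - (z ^ q - z) ^ 2 := fun z => by
    simp [hg, hg₀]
  have hexp : g ^ (2 * h + 1) = expand K (2 * h + 1) g := by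
    rw [← hh, hg, ← Polynomial.map_pow, FiniteField.pow_card_pow_eq_expand, map_expand]
  have hmain := FiniteField.two_mul_card_pow_eq_neg_one_le hgsq (by omega) hgdeg
    (by rw [hcard, hh]) hexp hqh
  have hzeros : (Finset.univ.filter fun z : K => g.eval z = 0).card ≤ 2 * q := by
    have hg0 : g ≠ 0 := fun h0 => by rw [h0, natDegree_zero] at hgdeg; omega
    rw [← hgdeg]
    refine (Finset.card_le_card fun z hz => ?_).trans
      ((Multiset.toFinset_card_le g.roots).trans (card_roots' g))
    rw [Multiset.mem_toFinset, mem_roots hg0]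
    exact (Finset.mem_filter.1 hz).2
  have hpt : ∀ z : K, (1 : ℤ) - (if g.eval z = 0 then 1 else 0) -
      2 * (if g.eval z ^ (Fintype.card K / 2) = -1 then 1 else 0) ≤ quadraticChar K (g.eval z) := by
    intro z
    by_cases hz : g.eval z = 0
    · rw [if_pos hz, hz, quadraticChar_zero]
      split_ifs <;> norm_num
    · rw [if_neg hz]
      rcases quadraticChar_dichotomy hz with h' | h'
      · rw [h']; split_ifs <;> norm_num
      · have := quadraticChar_eq_pow_of_char_ne_two' hK2 (g.eval z)
        rw [h'] at this ⊢
        rw [if_pos (by rw [← this]; simp)]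
        norm_num
  have hsum := Finset.sum_le_sum fun z (_ : z ∈ (Finset.univ : Finset K)) => hpt z
  rw [Finset.sum_sub_distrib, Finset.sum_sub_distrib, ← Finset.mul_sum, Finset.sum_boole,
    Finset.sum_boole, Finset.sum_const, Finset.card_univ, hcard, nsmul_eq_mul] at hsum
  simp only [hgev] at hsum hzeros hmain
  refine le_trans ?_ hsum
  rw [hh] at hcard ⊢
  rw [hcard] at hmain
  zify at hzeros hmain hqh
  push_cast
  nlinarith

/-! ### The Weil bound -/

theorem le_iterate_sq_sub_two {x : ℝ} (hx : 2 < |x|) (k : ℕ) :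
    2 + 4 ^ k * (x ^ 2 - 4) ≤ (fun x : ℝ => x ^ 2 - 2)^[k + 1] x := by
  have hx2 : 4 < x ^ 2 := by rw [← sq_abs]; nlinarith
  -- Each step multiplies the distance to the fixed point `2` by `y + 2 ≥ 4`.
  induction k with
  | zero => simp; linarith
  | succ k ih =>
    rw [Function.iterate_succ_apply', pow_succ]
    have : 0 < (4 : ℝ) ^ k * (x ^ 2 - 4) := by apply mul_pos <;> [positivity; linarith]
    nlinarith

/-- The Weil bound. If it failed for `χ`, then `|x| > 2` for the normalised sum `x`, and the iterates
of `x ↦ x ^ 2 - 2` at `x` would be unbounded. The same iterates for the other characters are at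
least `-2`, while Stepanov's bound keeps the sum over all characters bounded above. -/
theorem norm_conicSum_le {F : Type*} [Field F] [Fintype F] [DecidableEq F]
    (hF : Odd (Fintype.card F)) {c : F} (hc : c ≠ 0) {χ : AddChar F ℂ} (hχ : χ ≠ 1) :
    ‖conicSum c χ‖ ≤ 2 * √(Fintype.card F : ℝ) := by
  set q := Fintype.card F with hq
  have hq0 : (0 : ℝ) < q := by exact_mod_cast Fintype.card_pos
  have hs0 : 0 < √(q : ℝ) := Real.sqrt_pos.2 hq0
  set x : AddChar F ℂ → ℝ := fun ψ => -(conicSum c ψ).re / √(q : ℝ) with hx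
  by_contra! hcon
  have hxχ : 2 < |x χ| := by
    rw [hx, abs_div, abs_neg, abs_of_pos hs0, lt_div_iff₀ hs0, ← Real.norm_eq_abs,
      ← Complex.norm_real, conicSum_re]
    exact hcon
  have hbound : ∀ k, (fun x : ℝ => x ^ 2 - 2)^[k + 2] (x χ) ≤
      9 * q + 2 * Fintype.card (AddChar F ℂ) := by
    intro k
    obtain ⟨K, _, _, _, ι, τ, hτ, hτq, hcard, hsum⟩ :=
      exists_field_card_pow_two_pow_conicSum hF (k + 2)
    have hK : Odd (Fintype.card K) := by rw [hcard]; exact hF.pow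
    have hR : (√(q : ℝ)) ^ 2 ^ (k + 2) = (q : ℝ) ^ 2 ^ (k + 1) := by
      rw [pow_succ 2 (k + 1), mul_comm, pow_mul, Real.sq_sqrt hq0.le]
    have hlow := neg_le_sum_quadraticChar_sub_sq hF ι (n := 2 ^ (k + 1))
      (by rw [pow_succ]; have := Nat.one_le_two_pow (n := k); omega)
      (by rw [hcard, ← pow_mul, ← pow_succ]) hc
    have htot := sum_conicSum_compAddMonoidHom hτ hτq (ι c)
    have hone : (1 : AddChar F ℂ).compAddMonoidHom τ = 1 := by ext; simp
    rw [← Finset.add_sum_erase _ _ (Finset.mem_univ (1 : AddChar F ℂ)), hone,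
      conicSum_one hK ((map_ne_zero ι).2 hc),
      Finset.sum_congr rfl fun ψ hψ => hsum c hc ψ (Finset.ne_of_mem_erase hψ),
      ← Finset.mul_sum] at htot
    have htot' : -(quadraticChar K (-1) : ℝ) + -√(q : ℝ) ^ 2 ^ (k + 2) *
        ∑ ψ ∈ Finset.univ.erase (1 : AddChar F ℂ), (fun x : ℝ => x ^ 2 - 2)^[k + 2] (x ψ) =
        ((∑ z : K, quadraticChar K (ι c - (z ^ q - z) ^ 2) : ℤ) : ℝ) := by
      exact_mod_cast htot
    rw [hR] at htot'
    set R : ℝ := (q : ℝ) ^ 2 ^ (k + 1) with hRdef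
    have hR1 : 1 ≤ R := one_le_pow₀ (by exact_mod_cast Fintype.card_pos)
    have hq1 : (1 : ℝ) ≤ q := by exact_mod_cast Fintype.card_pos
    have hlow' : -(8 * q * R) ≤
        ((∑ z : K, quadraticChar K (ι c - (z ^ q - z) ^ 2) : ℤ) : ℝ) := by
      rw [hRdef]; exact_mod_cast hlow
    have hη : -1 ≤ (quadraticChar K (-1) : ℝ) := by
      rcases quadraticChar_dichotomy (F := K) (a := -1) (by simp) with h | h <;> rw [h] <;> norm_num
    rw [← Finset.add_sum_erase _ _ (Finset.mem_erase.2 ⟨hχ, Finset.mem_univ χ⟩)] at htot'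
    have hrest : -(2 * Fintype.card (AddChar F ℂ) : ℝ) ≤
        ∑ ψ ∈ (Finset.univ.erase (1 : AddChar F ℂ)).erase χ,
          (fun x : ℝ => x ^ 2 - 2)^[k + 2] (x ψ) := by
      have h1 : ∀ ψ ∈ (Finset.univ.erase (1 : AddChar F ℂ)).erase χ,
          (-2 : ℝ) ≤ (fun x : ℝ => x ^ 2 - 2)^[k + 2] (x ψ) := fun ψ _ => by
        rw [Function.iterate_succ_apply']
        nlinarith [sq_nonneg ((fun x : ℝ => x ^ 2 - 2)^[k + 1] (x ψ))]
      have h2 := Finset.card_nsmul_le_sum _ _ _ h1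
      rw [nsmul_eq_mul] at h2
      have h3 : (((Finset.univ.erase (1 : AddChar F ℂ)).erase χ).card : ℝ) ≤
          Fintype.card (AddChar F ℂ) := by exact_mod_cast Finset.card_le_univ _
      linarith
    set X := (fun x : ℝ => x ^ 2 - 2)^[k + 2] (x χ)
    have h4 : R * X ≤ R * (9 * q + 2 * Fintype.card (AddChar F ℂ)) := by nlinarith
    exact le_of_mul_le_mul_left h4 (by linarith)
  have hd : 0 < x χ ^ 2 - 4 := by
    have : 4 < x χ ^ 2 := by rw [← sq_abs]; nlinarith
    linarith
  obtain ⟨k, hk⟩ := pow_unbounded_of_one_lt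
    ((9 * q + 2 * Fintype.card (AddChar F ℂ)) / (x χ ^ 2 - 4)) (by norm_num : (1 : ℝ) < 4)
  rw [div_lt_iff₀ hd] at hk
  have h1 := le_iterate_sq_sub_two hxχ (k + 1)
  have h2 := hbound k
  have h3 : (4 : ℝ) ^ k * (x χ ^ 2 - 4) ≤ 4 ^ (k + 1) * (x χ ^ 2 - 4) := by
    exact mul_le_mul_of_nonneg_right
      (pow_le_pow_right₀ (by norm_num) (Nat.le_succ k)) hd.le
  linarith

/-! ### The orthogonal group and the circle -/

section

variable {F : Type*} [Field F] [Fintype F] [DecidableEq F]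

/-- The Fourier transform at the frequency `(u, v)` of the indicator function of the circle
`x ^ 2 + y ^ 2 = 1` over `F`. -/
def circleSum (u v : F) (χ : AddChar F ℂ) : ℂ :=
  ∑ x : F × F with x.1 ^ 2 + x.2 ^ 2 = 1, χ (u * x.1 + v * x.2)

/-- The number of square roots of `a`. -/
theorem sum_ite_sq_eq (hF : Odd (Fintype.card F)) (a : F) :
    ∑ s : F, (if s ^ 2 = a then (1 : ℂ) else 0) = 1 + (quadraticChar F a : ℂ) := by
  rw [sum_comp_sq hF (fun y => if y = a then (1 : ℂ) else 0)]
  simp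

/-- The line `u x + v y = t` meets the circle in `1 + η (u ^ 2 + v ^ 2 - t ^ 2)` points when the
direction `(u, v)` is not isotropic. -/
theorem circleSum_eq_conicSum (hF : Odd (Fintype.card F)) {u v : F} (h : u ^ 2 + v ^ 2 ≠ 0)
    {χ : AddChar F ℂ} (hχ : χ ≠ 1) : circleSum u v χ = conicSum (u ^ 2 + v ^ 2) χ := by
  set c := u ^ 2 + v ^ 2 with hc
  -- Coordinates `(t, s)` in the orthogonal basis `(u, v)`, `(-v, u)`: `t = u x + v y`, and the
  -- circle becomes `t ^ 2 + s ^ 2 = c`.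
  let E : F × F ≃ F × F :=
    { toFun := fun x => ((x.1 * u - x.2 * v) / c, (x.1 * v + x.2 * u) / c)
      invFun := fun x => (u * x.1 + v * x.2, u * x.2 - v * x.1)
      left_inv := fun x => by ext <;> (simp only; field_simp; rw [hc]; ring)
      right_inv := fun x => by ext <;> (simp only; field_simp; rw [hc]; ring) }
  have hE : ∀ t s : F, E (t, s) = ((t * u - s * v) / c, (t * v + s * u) / c) := fun _ _ => rfl
  rw [circleSum, Finset.sum_filter, ← Equiv.sum_comp E, Fintype.sum_prod_type]
  have h1 : ∀ t s : F, (if (E (t, s)).1 ^ 2 + (E (t, s)).2 ^ 2 = 1 then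
      χ (u * (E (t, s)).1 + v * (E (t, s)).2) else 0) =
      χ t * if s ^ 2 = c - t ^ 2 then (1 : ℂ) else 0 := by
    intro t s
    have e1 : ((t * u - s * v) / c) ^ 2 + ((t * v + s * u) / c) ^ 2 = (t ^ 2 + s ^ 2) / c := by
      field_simp; rw [hc]; ring
    have e2 : u * ((t * u - s * v) / c) + v * ((t * v + s * u) / c) = t := by
      field_simp; rw [hc]; ring
    simp only [hE]
    rw [e1, e2, mul_ite, mul_one, mul_zero]
    refine if_congr ((div_eq_one_iff_eq h).trans ⟨fun h => ?_, fun h => ?_⟩) rfl rfl <;>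
      linear_combination h
  simp only [h1]
  simp only [← Finset.mul_sum, sum_ite_sq_eq hF, mul_add, mul_one, Finset.sum_add_distrib]
  rw [AddChar.sum_eq_zero_of_ne_one hχ, zero_add, conicSum]

/-- For an isotropic frequency the circle is the hyperbola `p r = u ^ 2` in the coordinates
`p = u x + v y`, `r = u x - v y`, on which `p` takes each nonzero value once. -/
theorem circleSum_eq_neg_one (hF : Odd (Fintype.card F)) {u v : F} (h : u ^ 2 + v ^ 2 = 0)
    (huv : u ≠ 0 ∨ v ≠ 0) {χ : AddChar F ℂ} (hχ : χ ≠ 1) : circleSum u v χ = -1 := by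
  have h2 := FiniteField.two_ne_zero_of_odd_card hF
  have hu : u ≠ 0 := fun hu => by
    rw [hu] at h huv
    simp at h
    exact huv.elim (· rfl) (· h)
  have hv : v ≠ 0 := fun hv => hu (by rw [hv] at h; simpa using h)
  have hr : ∀ p : F, ∑ r : F, (if p * r = u ^ 2 then χ p else 0) = χ p - if p = 0 then 1 else 0 := by
    intro p
    by_cases hp : p = 0
    · rw [hp, if_pos rfl, AddChar.map_zero_eq_one, sub_self]
      refine Finset.sum_eq_zero fun r _ => if_neg ?_
      rw [zero_mul]
      exact (pow_ne_zero 2 hu).symm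
    · rw [if_neg hp, sub_zero, Finset.sum_eq_single (u ^ 2 / p)]
      · rw [if_pos (by field_simp)]
      · intro r _ hr
        exact if_neg fun h => hr (by rw [← h]; field_simp)
      · simp
  let E : F × F ≃ F × F :=
    { toFun := fun x => ((x.1 + x.2) / (2 * u), (x.1 - x.2) / (2 * v))
      invFun := fun x => (u * x.1 + v * x.2, u * x.1 - v * x.2)
      left_inv := fun x => by ext <;> (simp only; field_simp; ring)
      right_inv := fun x => by ext <;> (simp only; field_simp; ring) }
  have hE : ∀ t s : F, E (t, s) = ((t + s) / (2 * u), (t - s) / (2 * v)) := fun _ _ => rfl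
  rw [circleSum, Finset.sum_filter, ← Equiv.sum_comp E, Fintype.sum_prod_type]
  have h1 : ∀ p r : F, (if (E (p, r)).1 ^ 2 + (E (p, r)).2 ^ 2 = 1 then
      χ (u * (E (p, r)).1 + v * (E (p, r)).2) else 0) =
      if p * r = u ^ 2 then χ p else 0 := by
    intro p r
    have hv2 : v ^ 2 = -u ^ 2 := by linear_combination h
    have e1 : ((p + r) / (2 * u)) ^ 2 + ((p - r) / (2 * v)) ^ 2 = (p * r) / u ^ 2 := by
      rw [div_pow, div_pow, mul_pow, mul_pow, hv2]
      field_simp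
      ring
    have e2 : u * ((p + r) / (2 * u)) + v * ((p - r) / (2 * v)) = p := by
      field_simp; ring
    simp only [hE]
    rw [e1, e2]
    exact if_congr (div_eq_one_iff_eq (pow_ne_zero 2 hu)) rfl rfl
  simp only [h1, hr, Finset.sum_sub_distrib]
  rw [AddChar.sum_eq_zero_of_ne_one hχ]
  simp

theorem norm_circleSum_le (hF : Odd (Fintype.card F)) {u v : F} (huv : u ≠ 0 ∨ v ≠ 0)
    {χ : AddChar F ℂ} (hχ : χ ≠ 1) : ‖circleSum u v χ‖ ≤ 2 * √(Fintype.card F : ℝ) := by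
  by_cases h : u ^ 2 + v ^ 2 = 0
  · rw [circleSum_eq_neg_one hF h huv hχ, norm_neg, norm_one]
    have : 1 ≤ √(Fintype.card F : ℝ) := Real.one_le_sqrt.2 (by exact_mod_cast Fintype.card_pos)
    linarith
  · rw [circleSum_eq_conicSum hF h hχ]
    exact norm_conicSum_le hF h hχ

theorem card_circle (hF : Odd (Fintype.card F)) :
    ((Finset.univ.filter fun x : F × F => x.1 ^ 2 + x.2 ^ 2 = 1).card : ℂ) =
      Fintype.card F - (quadraticChar F (-1) : ℂ) := by
  rw [← Finset.sum_boole, Fintype.sum_prod_type]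
  have h1 : ∀ x y : F, (if x ^ 2 + y ^ 2 = 1 then (1 : ℂ) else 0) =
      if y ^ 2 = 1 - x ^ 2 then 1 else 0 := fun x y =>
    if_congr ⟨fun h => by linear_combination h, fun h => by linear_combination h⟩ rfl rfl
  simp only [h1, sum_ite_sq_eq hF, Finset.sum_add_distrib]
  have h2 := conicSum_one hF (one_ne_zero (α := F))
  simp only [conicSum, AddChar.one_apply, one_mul] at h2
  rw [h2, Finset.sum_const, Finset.card_univ, nsmul_eq_mul, mul_one, sub_eq_add_neg]

theorem norm_circleSum_le_card (hF : Odd (Fintype.card F)) (u v : F) (χ : AddChar F ℂ) :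
    ‖circleSum u v χ‖ ≤ Fintype.card F - (quadraticChar F (-1) : ℝ) := by
  have h : ((Finset.univ.filter fun x : F × F => x.1 ^ 2 + x.2 ^ 2 = 1).card : ℝ) =
      Fintype.card F - (quadraticChar F (-1) : ℝ) := by
    exact_mod_cast card_circle hF
  rw [← h]
  refine (norm_sum_le _ _).trans ?_
  simp

/-- The rotations `!![x, -y; y, x]` and the reflections `!![x, y; y, -x]` are two copies of the
circle, on each of which `Tr (A g)` is a linear form in `(x, y)`. -/
theorem cayleyEigenvalue_orthogonalGroup_vecMulVec (hF : Odd (Fintype.card F))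
    (χ : AddChar F ℂ) (w : Fin 2 → F) (a b : F) :
    cayleyEigenvalue (Matrix.orthogonalGroup (Fin 2) F) χ (Matrix.vecMulVec w ![a, b]) =
      circleSum (a * w 0 + b * w 1) (b * w 0 - a * w 1) χ +
        circleSum (a * w 0 - b * w 1) (b * w 0 + a * w 1) χ := by
  have h2 := FiniteField.two_ne_zero_of_odd_card hF
  have hmem : ∀ g : Matrix (Fin 2) (Fin 2) F, g ∈ (Matrix.orthogonalGroup (Fin 2) F : Set _) ↔
      g 0 0 ^ 2 + g 0 1 ^ 2 = 1 ∧ g 0 0 * g 1 0 + g 0 1 * g 1 1 = 0 ∧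
        g 1 0 ^ 2 + g 1 1 ^ 2 = 1 := by
    intro g
    rw [SetLike.mem_coe, Matrix.mem_orthogonalGroup_iff, ← Matrix.ext_iff]
    simp only [Fin.forall_fin_two, Matrix.mul_apply, Fin.sum_univ_two, Matrix.transpose_apply,
      Matrix.one_apply]
    simp only [if_true, Fin.isValue, zero_ne_one, one_ne_zero, if_false]
    constructor
    · rintro ⟨⟨e1, e2⟩, e3, e4⟩
      exact ⟨by linear_combination e1, e2, by linear_combination e4⟩
    · rintro ⟨e1, e2, e3⟩
      exact ⟨⟨by linear_combination e1, e2⟩, by linear_combination e2, by linear_combination e3⟩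
  have htr : ∀ g : Matrix (Fin 2) (Fin 2) F, (Matrix.vecMulVec w ![a, b] * g).trace =
      a * w 0 * g 0 0 + a * w 1 * g 0 1 + b * w 0 * g 1 0 + b * w 1 * g 1 1 := by
    intro g
    simp [Matrix.trace, Fin.sum_univ_two, Matrix.mul_apply]
    ring
  -- Split `O(2)` into rotations and reflections by the value of the determinant.
  rw [cayleyEigenvalue, ← Finset.sum_filter_add_sum_filter_not _ (fun g =>
    g 0 0 * g 1 1 - g 0 1 * g 1 0 = 1)]
  congr 1
  · refine Finset.sum_nbij' (fun g => (g 0 0, g 1 0)) (fun x => !![x.1, -x.2; x.2, x.1])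
      ?_ ?_ ?_ ?_ ?_
    · intro g hg
      simp only [Finset.mem_filter, Finset.mem_univ, true_and, hmem] at hg ⊢
      obtain ⟨⟨e1, e2, e3⟩, e4⟩ := hg
      have e5 : g 1 0 = -g 0 1 := by
        linear_combination (-g 1 0) * e1 + g 0 0 * e2 - g 0 1 * e4
      rw [e5]
      linear_combination e1
    · intro x hx
      simp only [Finset.mem_filter, Finset.mem_univ, true_and, hmem] at hx ⊢
      simp
      refine ⟨⟨hx, by ring, by linear_combination hx⟩, by linear_combination hx⟩
    · intro g hg
      simp only [Finset.mem_filter, Finset.mem_univ, true_and, hmem] at hg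
      obtain ⟨⟨e1, e2, e3⟩, e4⟩ := hg
      have e5 : g 1 0 = -g 0 1 := by
        linear_combination (-g 1 0) * e1 + g 0 0 * e2 - g 0 1 * e4
      have e6 : g 0 0 = g 1 1 := by
        linear_combination g 1 1 * e1 - g 0 1 * e2 - g 0 0 * e4
      ext i j
      fin_cases i <;> fin_cases j <;> simp [e5, e6]
    · intro x _
      simp
    · intro g hg
      simp only [Finset.mem_filter, Finset.mem_univ, true_and, hmem] at hg
      obtain ⟨⟨e1, e2, e3⟩, e4⟩ := hg
      have e5 : g 1 0 = -g 0 1 := by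
        linear_combination (-g 1 0) * e1 + g 0 0 * e2 - g 0 1 * e4
      have e6 : g 0 0 = g 1 1 := by
        linear_combination g 1 1 * e1 - g 0 1 * e2 - g 0 0 * e4
      rw [htr]
      congr 1
      simp only
      rw [e5, e6]
      ring
  · have hdet : ∀ g : Matrix (Fin 2) (Fin 2) F, g 0 0 ^ 2 + g 0 1 ^ 2 = 1 →
        g 0 0 * g 1 0 + g 0 1 * g 1 1 = 0 → g 1 0 ^ 2 + g 1 1 ^ 2 = 1 →
        g 0 0 * g 1 1 - g 0 1 * g 1 0 ≠ 1 → g 1 0 = g 0 1 ∧ g 1 1 = -g 0 0 := by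
      intro g e1 e2 e3 e4
      have e5 : g 0 0 * g 1 1 - g 0 1 * g 1 0 = -1 := by
        have : (g 0 0 * g 1 1 - g 0 1 * g 1 0) ^ 2 = 1 := by
          linear_combination e1 * (g 1 0 ^ 2 + g 1 1 ^ 2) + e3 -
            (g 0 0 * g 1 0 + g 0 1 * g 1 1) * e2
        exact (mul_self_eq_one_iff.1 (by rw [← sq]; exact this)).resolve_left e4
      constructor
      · linear_combination (-g 1 0) * e1 + g 0 0 * e2 - g 0 1 * e5
      · linear_combination -g 1 1 * e1 + g 0 1 * e2 + g 0 0 * e5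
    refine Finset.sum_nbij' (fun g => (g 0 0, g 1 0)) (fun x => !![x.1, x.2; x.2, -x.1])
      ?_ ?_ ?_ ?_ ?_
    · intro g hg
      simp only [Finset.mem_filter, Finset.mem_univ, true_and, hmem] at hg ⊢
      obtain ⟨⟨e1, e2, e3⟩, e4⟩ := hg
      rw [(hdet g e1 e2 e3 e4).1, e1]
    · intro x hx
      simp only [Finset.mem_filter, Finset.mem_univ, true_and, hmem] at hx ⊢
      simp
      refine ⟨⟨hx, by ring, by linear_combination hx⟩, fun h => h2 ?_⟩
      linear_combination -hx - h
    · intro g hg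
      simp only [Finset.mem_filter, Finset.mem_univ, true_and, hmem] at hg
      obtain ⟨⟨e1, e2, e3⟩, e4⟩ := hg
      obtain ⟨e5, e6⟩ := hdet g e1 e2 e3 e4
      ext i j
      fin_cases i <;> fin_cases j <;> simp [e5, e6]
    · intro x _
      simp
    · intro g hg
      simp only [Finset.mem_filter, Finset.mem_univ, true_and, hmem] at hg
      obtain ⟨⟨e1, e2, e3⟩, e4⟩ := hg
      obtain ⟨e5, e6⟩ := hdet g e1 e2 e3 e4
      rw [htr]
      congr 1
      simp only
      rw [e5, e6]
      ring

end

theorem mainTheorem11 {F : Type*} [Field F] [Fintype F] (hodd : Odd (Fintype.card F))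
    (χ : AddChar F ℂ) (hχ : χ ≠ 1)
    {K : Type*} [Field K] [Algebra F K] (i : K) (hi : i ^ 2 = -1)
    (A : Matrix (Fin 2) (Fin 2) F) (hA : A.rank = 1)
    (w : Fin 2 → F) (a b : F) (hwab : A = Matrix.vecMulVec w ![a, b]) :
    (algebraMap F K a ≠ algebraMap F K b * i ∧ algebraMap F K a ≠ -(algebraMap F K b * i) →
      ‖cayleyEigenvalue (Matrix.orthogonalGroup (Fin 2) F) χ A‖ ≤ 4 * √(Fintype.card F : ℝ)) ∧
    (algebraMap F K a = algebraMap F K b * i ∨ algebraMap F K a = -(algebraMap F K b * i) →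
      (Fintype.card F % 4 = 3 →
        ‖cayleyEigenvalue (Matrix.orthogonalGroup (Fin 2) F) χ A‖ ≤
          ((Fintype.card F : ℝ) + 1) + 2 * √(Fintype.card F : ℝ)) ∧
      (Fintype.card F % 4 ≠ 3 →
        ‖cayleyEigenvalue (Matrix.orthogonalGroup (Fin 2) F) χ A‖ ≤
          ((Fintype.card F : ℝ) - 1) + 2 * √(Fintype.card F : ℝ))) := by
  classical
  have h2 := FiniteField.two_ne_zero_of_odd_card hodd
  have hA0 : A ≠ 0 := fun h => by rw [h, Matrix.rank_zero] at hA; exact zero_ne_one hA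
  have hw : w 0 ≠ 0 ∨ w 1 ≠ 0 := by
    by_contra! h
    refine hA0 ?_
    rw [hwab]
    ext k l
    fin_cases k <;> simp [Matrix.vecMulVec_apply, h.1, h.2]
  have hab : a ≠ 0 ∨ b ≠ 0 := by
    by_contra! h
    refine hA0 ?_
    rw [hwab]
    ext k l
    fin_cases l <;> simp [Matrix.vecMulVec_apply, h.1, h.2]
  rw [hwab, cayleyEigenvalue_orthogonalGroup_vecMulVec hodd]
  set u := a * w 0 + b * w 1 with hu
  set v := b * w 0 - a * w 1 with hv
  set u' := a * w 0 - b * w 1 with hu'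
  set v' := b * w 0 + a * w 1 with hv'
  constructor
  · rintro ⟨h1, h1'⟩
    -- Now `(a, b)` is not isotropic, so neither frequency vanishes.
    have hne : a ^ 2 + b ^ 2 ≠ 0 := fun h => by
      have h3 : (algebraMap F K a - algebraMap F K b * i) *
          (algebraMap F K a + algebraMap F K b * i) = 0 := by
        have := congrArg (algebraMap F K) h
        rw [map_add, map_pow, map_pow, map_zero] at this
        linear_combination this - algebraMap F K b ^ 2 * hi
      rcases mul_eq_zero.1 h3 with h4 | h4
      · exact h1 (by linear_combination h4)
      · exact h1' (by linear_combination h4)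
    have huv : u ≠ 0 ∨ v ≠ 0 := by
      by_contra! h
      have e0 : (a ^ 2 + b ^ 2) * w 0 = 0 := by linear_combination a * h.1 + b * h.2
      have e1 : (a ^ 2 + b ^ 2) * w 1 = 0 := by linear_combination b * h.1 - a * h.2
      exact hw.elim (· ((mul_eq_zero.1 e0).resolve_left hne))
        (· ((mul_eq_zero.1 e1).resolve_left hne))
    have huv' : u' ≠ 0 ∨ v' ≠ 0 := by
      by_contra! h
      have e0 : (a ^ 2 + b ^ 2) * w 0 = 0 := by linear_combination a * h.1 + b * h.2
      have e1 : (a ^ 2 + b ^ 2) * w 1 = 0 := by linear_combination a * h.2 - b * h.1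
      exact hw.elim (· ((mul_eq_zero.1 e0).resolve_left hne))
        (· ((mul_eq_zero.1 e1).resolve_left hne))
    refine (norm_add_le _ _).trans ?_
    linarith [norm_circleSum_le hodd huv hχ, norm_circleSum_le hodd huv' hχ]
  · intro _
    -- At least one frequency is nonzero; the other sum is at most the size `q - η (-1)` of the
    -- circle.
    have hbound : ‖circleSum u v χ + circleSum u' v' χ‖ ≤
        (Fintype.card F - (quadraticChar F (-1) : ℝ)) + 2 * √(Fintype.card F : ℝ) := by
      refine (norm_add_le _ _).trans ?_
      by_cases huv : u ≠ 0 ∨ v ≠ 0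
      · linarith [norm_circleSum_le hodd huv hχ, norm_circleSum_le_card hodd u' v' χ]
      · have huv' : u' ≠ 0 ∨ v' ≠ 0 := by
          by_contra! h
          push Not at huv
          have e1 : a * w 0 = 0 := by
            apply (mul_eq_zero.1 (_ : 2 * (a * w 0) = 0)).resolve_left h2
            linear_combination h.1 + huv.1
          have e2 : b * w 1 = 0 := by
            apply (mul_eq_zero.1 (_ : 2 * (b * w 1) = 0)).resolve_left h2
            linear_combination huv.1 - h.1
          have e3 : b * w 0 = 0 := by
            apply (mul_eq_zero.1 (_ : 2 * (b * w 0) = 0)).resolve_left h2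
            linear_combination h.2 + huv.2
          have e4 : a * w 1 = 0 := by
            apply (mul_eq_zero.1 (_ : 2 * (a * w 1) = 0)).resolve_left h2
            linear_combination h.2 - huv.2
          simp only [mul_eq_zero] at e1 e2 e3 e4
          tauto
        linarith [norm_circleSum_le hodd huv' hχ, norm_circleSum_le_card hodd u v χ]
    constructor
    · intro h3
      have : quadraticChar F (-1) = -1 := by
        rw [quadraticChar_neg_one_iff_not_isSquare, FiniteField.isSquare_neg_one_iff]
        exact fun h => h h3
      rw [this] at hbound
      push_cast at hbound
      linarith
    · intro h3
      have : quadraticChar F (-1) = 1 := by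
        rw [quadraticChar_one_iff_isSquare (by simp), FiniteField.isSquare_neg_one_iff]
        exact h3
      rw [this] at hbound
      push_cast at hbound
      linarith
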